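/- For $m\ge 0$ let $\mathbb{S}^m=\{x\in\mathbb{R}^{m+1}:\|x\|=1\}$ carry the geodesic distance $d(x,x')=\arccos\langle x,x'\rangle$, and let $\mathbf{H}_{\ge 0}(\mathbb{S}^2)=\{x\in\mathbb{S}^2: x_3\ge 0\}$ carry the restricted distance. A correspondence between sets $X$ and $Y$ is a relation $R\subseteq X\times Y$ whose projections to $X$ and to $Y$ are onto; for metric spaces $X,Y$ its distortion is $\operatorname{dis}(R)=\sup_{(x,y),(x',y')\in R}|d_X(x,x')-d_Y(y,y')|$. The Gromov-Hausdorff distance $d_{GH}(X,Y)$ is the infimum of the Hausdorff distances $d_H(f(X),g(Y))$ over all metric spaces $Z$ and all isometric embeddings $f:X\to Z$, $g:Y\to Z$. There exist (1) a correspondence $R_1$ between $\mathbb{S}^1$ and $\mathbf{H}_{\ge 0}(\mathbb{S}^2)$ and (2) a correspondence $R_2$ between $\mathbb{S}^1$ and $\mathbb{S}^2$, both of distortion at most $\frac{2\pi}{3}$. They can be taken to be the graphs (with the coordinates swapped) of the following maps $\psi:\mathbf{H}_{\ge 0}(\mathbb{S}^2)\to\mathbb{S}^1$ and $\varphi:\mathbb{S}^2\to\mathbb{S}^1$.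 Let $w_1=(1,0)$, $w_2=(-\frac12,\frac{\sqrt3}{2})$, $w_3=(-\frac12,-\frac{\sqrt3}{2})$ and $u_i=(w_i,0)\in\mathbb{S}^2$. Then $\psi(x,0)=x$ for $x\in\mathbb{S}^1$, and, for $p\in\mathbb{S}^2$ with $p_3>0$, $\psi(p)=w_i$, where $i$ is the smallest index for which $d(p,u_i)=\min_j d(p,u_j)$. The map $\varphi$ is the antipode preserving map ($\varphi(-p)=-\varphi(p)$ for all $p$) that agrees with $\psi$ on the set of all $p\in\mathbb{S}^2$ with $p_3>0$, or $p_3=0$ and $p_2>0$, or $p=(1,0,0)$. Moreover, $d_{GH}(\mathbb{S}^1,\mathbb{S}^2)=\frac{\pi}{3}$. -/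

import Mathlib

open scoped ENNReal

noncomputable section

/-- The unit sphere `S^m` in `ℝ^(m+1)`.  It is a type of its own, so that it carries the geodesic
distance defined below and not the Euclidean one. -/
@[ext]
structure GeoSphere (m : ℕ) where
  val : EuclideanSpace ℝ (Fin (m + 1))
  norm_val : ‖val‖ = 1

namespace GeoSphere

variable {m : ℕ}

theorem val_ne_zero (x : GeoSphere m) : x.val ≠ 0 := by
  intro h
  have := x.norm_val
  simp [h] at this

/-- The geodesic distance `d(x, y) = arccos ⟨x, y⟩`. -/
instance : Dist (GeoSphere m) where
  dist x y := Real.arccos (inner ℝ x.val y.val)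

theorem dist_def (x y : GeoSphere m) : dist x y = Real.arccos (inner ℝ x.val y.val) := rfl

theorem dist_eq_angle (x y : GeoSphere m) :
    dist x y = InnerProductGeometry.angle x.val y.val := by
  simp [dist_def, InnerProductGeometry.angle, x.norm_val, y.norm_val]

instance : MetricSpace (GeoSphere m) where
  dist_self x := by
    rw [dist_eq_angle, InnerProductGeometry.angle_self x.val_ne_zero]
  dist_comm x y := by
    rw [dist_eq_angle, dist_eq_angle, InnerProductGeometry.angle_comm]
  dist_triangle x y z := by
    simp only [dist_eq_angle]
    exact InnerProductGeometry.angle_le_angle_add_angle _ _ _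
  eq_of_dist_eq_zero := by
    intro x y h
    rw [dist_eq_angle, ← InnerProductGeometry.inner_eq_mul_norm_iff_angle_eq_zero
      x.val_ne_zero y.val_ne_zero, x.norm_val, y.norm_val, mul_one,
      inner_eq_one_iff_of_norm_eq_one x.norm_val y.norm_val] at h
    exact GeoSphere.ext h

instance : CompactSpace (GeoSphere m) := by
  let f : Metric.sphere (0 : EuclideanSpace ℝ (Fin (m + 1))) 1 → GeoSphere m :=
    fun x => ⟨x.1, by simp⟩
  have hf : Continuous f := by
    refine continuous_iff_continuousAt.2 fun x => tendsto_iff_dist_tendsto_zero.2 ?_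
    have hc : Continuous fun y : Metric.sphere (0 : EuclideanSpace ℝ (Fin (m + 1))) 1 =>
        Real.arccos (inner ℝ y.1 x.1) :=
      Real.continuous_arccos.comp (continuous_subtype_val.inner continuous_const)
    have h := hc.tendsto x
    have h0 : Real.arccos (inner ℝ x.1 x.1) = 0 := by
      simp
    rw [h0] at h
    exact h
  have hs : Function.Surjective f := fun y => ⟨⟨y.val, by simp [y.norm_val]⟩, rfl⟩
  exact ⟨by rw [← hs.range_eq]; exact isCompact_range hf⟩

instance : Nonempty (GeoSphere m) :=
  ⟨⟨EuclideanSpace.single 0 1, by simp⟩⟩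

/-- The antipodal map `x ↦ -x`. -/
instance : Neg (GeoSphere m) where
  neg x := ⟨-x.val, by rw [norm_neg, x.norm_val]⟩

/-- The closed upper hemisphere of `S^m`: the last coordinate is nonnegative.  Used as a type it
carries the restriction of the geodesic distance of `S^m`. -/
def closedUpperHemisphere (m : ℕ) : Set (GeoSphere m) :=
  {x | 0 ≤ x.val (Fin.last m)}

/-- The open upper hemisphere of `S^m`: the last coordinate is positive. -/
def openUpperHemisphere (m : ℕ) : Set (GeoSphere m) :=
  {x | 0 < x.val (Fin.last m)}

/-- The equatorial embedding `S^m → S^(m+1)`, `(x_1, …, x_(m+1)) ↦ (x_1, …, x_(m+1), 0)`. -/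
def equatorial (x : GeoSphere m) : GeoSphere (m + 1) where
  val := WithLp.toLp 2 (Fin.snoc (α := fun _ => ℝ) (fun i => x.val i) 0)
  norm_val := by
    have h := x.norm_val
    rw [EuclideanSpace.norm_eq] at h ⊢
    rw [Fin.sum_univ_castSucc]
    simpa using h

theorem equatorial_mem_closedUpperHemisphere (x : GeoSphere m) :
    x.equatorial ∈ closedUpperHemisphere (m + 1) := by
  simp [closedUpperHemisphere, equatorial]

/-- A fundamental domain of the antipodal map: `A(S^0) = {1}`, and `A(S^(n+1))` is the union of the
open upper hemisphere of `S^(n+1)` and the copy of `A(S^n)` in the equator. -/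
def helmet : (n : ℕ) → Set (GeoSphere n)
  | 0 => {x | x.val 0 = 1}
  | n + 1 => openUpperHemisphere (n + 1) ∪ equatorial '' helmet n

/-- The vertices of a regular triangle inscribed in `S^1`. -/
def triangle (i : Fin 3) : GeoSphere 1 where
  val := ![!₂[1, 0], !₂[-1 / 2, √3 / 2], !₂[-1 / 2, -(√3 / 2)]] i
  norm_val := by
    have h3 : (√3 : ℝ) ^ 2 = 3 := Real.sq_sqrt (by norm_num)
    rw [EuclideanSpace.norm_eq, Real.sqrt_eq_one]
    fin_cases i <;> simp [Fin.sum_univ_two, div_pow, h3] <;> norm_num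

/-- The Voronoi cell in the open upper hemisphere of `S^2` of the `i`-th vertex of the triangle,
placed in the equator.  Ties go to the smallest index. -/
def voronoiCell (i : Fin 3) : Set (GeoSphere 2) :=
  {x | x ∈ openUpperHemisphere 2 ∧
    (∀ j, j ≠ i → dist x (triangle i).equatorial ≤ dist x (triangle j).equatorial) ∧
    (∀ j, j < i → dist x (triangle i).equatorial < dist x (triangle j).equatorial)}

/-- `ψ` is the map from the closed upper hemisphere to `S^1` that is constant on each Voronoi cell,
with value the vertex of that cell, and that is the identity on the equator. -/
def IsVoronoiMap (ψ : closedUpperHemisphere 2 → GeoSphere 1) : Prop :=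
  (∀ (i : Fin 3) (p : closedUpperHemisphere 2), p.1 ∈ voronoiCell i → ψ p = triangle i) ∧
  (∀ x : GeoSphere 1, ψ ⟨x.equatorial, x.equatorial_mem_closedUpperHemisphere⟩ = x)

/-- `φ` is the antipode preserving map on `S^2` that agrees with `ψ` on `A(S^2)`. -/
def IsOddExtension (ψ : closedUpperHemisphere 2 → GeoSphere 1) (φ : GeoSphere 2 → GeoSphere 1) :
    Prop :=
  (∀ x : GeoSphere 2, φ (-x) = -φ x) ∧
  (∀ p : closedUpperHemisphere 2, p.1 ∈ helmet 2 → φ p.1 = ψ p)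

end GeoSphere

/-- A relation `R ⊆ X × Y` is a correspondence if both projections map it onto the factor. -/
def IsCorrespondence {X Y : Type*} (R : Set (X × Y)) : Prop :=
  Prod.fst '' R = Set.univ ∧ Prod.snd '' R = Set.univ

/-- The distortion of a relation, the supremum of `|d(x, x') - d(y, y')|` over `(x, y)` and
`(x', y')` in `R`, as an extended nonnegative real. -/
def distortion {X Y : Type*} [MetricSpace X] [MetricSpace Y] (R : Set (X × Y)) : ℝ≥0∞ :=
  ⨆ p ∈ R, ⨆ q ∈ R, ENNReal.ofReal |dist p.1 q.1 - dist p.2 q.2|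

/-- The graph of a map `f : Y → X`, as a relation between `X` and `Y`. -/
def graphRel {X Y : Type*} (f : Y → X) : Set (X × Y) :=
  {p | f p.2 = p.1}

end

/-! The lower bound is a Borsuk-Ulam argument. If `g : S^2 → S^1` had distortion below 2π/3, a
partition-of-unity sum of the vectors g(y) for net points y near x and -g(y) for y near -x would be
a continuous odd map from S^2 to the plane. The points entering with positive weight are pairwise
closer than 2π/3, so Carathéodory's theorem in the plane keeps the sum away from 0
(`sum_smul_val_ne_zero`), against `exists_eq_zero_of_odd`. Embeddings at Hausdorff distance below r
give such a g with distortion at most 2r, whence π/3 ≤ d_GH.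

The upper bound comes from ψ. Two points of one Voronoi cell are at distance at most 2π/3, since the
cell lies over a planar sector of half-angle π/3. Values on different cells are exactly 2π/3 apart,
and every distance lies in [0, π]. Against an equatorial point, the error is at most the distance
from a cell point to its vertex. Negating a point and its value turns both distances into π minus
themselves, so the odd extension φ has no larger distortion. A surjection of distortion D gives d_GH
≤ D/2. -/

/-- A continuous map on a preconnected space is constant if its exponential is. -/
theorem Complex.eq_of_exp_comp_eq {X : Type*} [TopologicalSpace X] [PreconnectedSpace X]
    {u : X → ℂ} (hu : Continuous u) {c : ℂ} (h : ∀ x, Complex.exp (u x) = c) (x y : X) :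
    u x = u y := by
  have := Complex.isCoveringMap_exp.eq_of_comp_eq hu (continuous_const (y := u y))
    (by ext z; simp [h]) y rfl
  exact congrFun this x

/-- A nowhere vanishing continuous function on the plane has a continuous logarithm. -/
theorem Complex.exists_continuous_exp_eq {f : ℝ × ℝ → ℂ} (hf : Continuous f)
    (h0 : ∀ x, f x ≠ 0) : ∃ u : ℝ × ℝ → ℂ, Continuous u ∧ ∀ x, Complex.exp (u x) = f x := by
  obtain ⟨F, ⟨-, hF⟩, -⟩ := Complex.isCoveringMapOn_exp.existsUnique_continuousMap_lifts
    (⟨f, hf⟩ : C(ℝ × ℝ, ℂ)) (a₀ := 0) (e₀ := Complex.log (f 0))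
    (by simp [Complex.exp_log (h0 0)]) (fun a => by simpa using h0 a)
  exact ⟨F, F.continuous, fun x => congrFun hF x⟩

/-! ### Borsuk-Ulam on S^2 by continuous logarithms -/

namespace GeoSphere

/-- The point of `S^2` with longitude `p.1` and latitude `p.2`. -/
noncomputable def ofLonLat (p : ℝ × ℝ) : GeoSphere 2 where
  val := !₂[Real.cos p.2 * Real.cos p.1, Real.cos p.2 * Real.sin p.1, Real.sin p.2]
  norm_val := by
    rw [EuclideanSpace.norm_eq, Real.sqrt_eq_one]
    simp only [Fin.sum_univ_three, Real.norm_eq_abs, sq_abs]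
    simp
    nlinarith [Real.sin_sq_add_cos_sq p.1, Real.sin_sq_add_cos_sq p.2]

@[simp] theorem neg_val {m : ℕ} (x : GeoSphere m) : (-x).val = -x.val := rfl

theorem ofLonLat_antipode (s t : ℝ) : ofLonLat (s + Real.pi, -t) = -ofLonLat (s, t) := by
  ext i
  fin_cases i <;> simp [ofLonLat]

theorem ofLonLat_add_two_pi (s t : ℝ) : ofLonLat (s + 2 * Real.pi, t) = ofLonLat (s, t) := by
  ext i
  fin_cases i <;> simp [ofLonLat]

theorem ofLonLat_pole (s : ℝ) : ofLonLat (s, Real.pi / 2) = ofLonLat (0, Real.pi / 2) := by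
  ext i
  fin_cases i <;> simp [ofLonLat]

theorem continuous_of_continuous_val {X : Type*} [TopologicalSpace X] {m : ℕ}
    {f : X → GeoSphere m} (hf : Continuous fun x => (f x).val) : Continuous f := by
  refine continuous_iff_continuousAt.2 fun x => tendsto_iff_dist_tendsto_zero.2 ?_
  have hc : Continuous fun y => dist (f y) (f x) := by
    simp only [dist_def]
    exact Real.continuous_arccos.comp (hf.inner continuous_const)
  simpa using hc.tendsto x

theorem continuous_ofLonLat : Continuous ofLonLat := by
  refine continuous_of_continuous_val ?_
  refine (PiLp.continuous_toLp 2 _).comp (continuous_pi fun i => ?_)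
  fin_cases i <;> simp <;> fun_prop

/-- The two-dimensional Borsuk-Ulam theorem. -/
theorem exists_eq_zero_of_odd {f : GeoSphere 2 → ℂ} (hf : Continuous f)
    (hodd : ∀ x, f (-x) = -f x) : ∃ x, f x = 0 := by
  by_contra! h0
  obtain ⟨u, hu, hexp⟩ := Complex.exists_continuous_exp_eq (hf.comp continuous_ofLonLat)
    (fun x => h0 _)
  -- The increment of `u` over one turn of longitude is constant, and it vanishes at the pole.
  have hpole : u (2 * Real.pi, Real.pi / 2) = u (0, Real.pi / 2) :=
    Complex.eq_of_exp_comp_eq (u := fun s : ℝ => u (s, Real.pi / 2))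
      (c := f (ofLonLat (0, Real.pi / 2)))
      (by fun_prop) (fun s => by rw [hexp, Function.comp_apply, ofLonLat_pole]) _ _
  have hper := Complex.eq_of_exp_comp_eq
    (u := fun p : ℝ × ℝ => u (p.1 + 2 * Real.pi, p.2) - u p) (c := 1) (by fun_prop)
    (fun p => by
      rw [Complex.exp_sub, hexp, hexp, Function.comp_apply, Function.comp_apply,
        ofLonLat_add_two_pi, div_self (h0 _)])
  have hanti_exp (p : ℝ × ℝ) : Complex.exp (u (p.1 + Real.pi, -p.2) - u p) = -1 := by
    rw [Complex.exp_sub, hexp, hexp, Function.comp_apply, Function.comp_apply,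
      ofLonLat_antipode, hodd, neg_div, div_self (h0 _)]
  -- The increment along the antipodal map is also a constant, with exponential -1. Two half turns
  -- of the equator make a full turn, so twice this constant is 0.
  have hanti := Complex.eq_of_exp_comp_eq
    (u := fun p : ℝ × ℝ => u (p.1 + Real.pi, -p.2) - u p) (by fun_prop) hanti_exp
  have h1 := hper (0, 0) (0, Real.pi / 2)
  have h2 := hanti (Real.pi, 0) (0, 0)
  have h3 := hanti_exp (0, 0)
  simp only [zero_add, neg_zero, hpole, sub_self] at h1 h2 h3
  rw [← two_mul] at h2
  have h4 : u (Real.pi, 0) - u (0, 0) = 0 := by linear_combination (h1 - h2) / 2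
  rw [h4, Complex.exp_zero] at h3
  norm_num at h3

/-! ### Positive combinations of nearby points of the circle -/

/-- Finitely many weighted points of `S^1` at pairwise distance less than `2π/3` do not balance at
the origin. -/
theorem sum_smul_val_ne_zero {ι : Type*} [Fintype ι] (w : ι → ℝ) (v : ι → GeoSphere 1)
    (hw : ∀ i, 0 ≤ w i) (hpos : ∃ i, 0 < w i)
    (hv : ∀ i j, 0 < w i → 0 < w j → dist (v i) (v j) < 2 * Real.pi / 3) :
    ∑ i, w i • (v i).val ≠ 0 := by
  classical
  intro h
  have hsum : 0 < ∑ i, w i := by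
    obtain ⟨i, hi⟩ := hpos
    exact Finset.sum_pos' (fun i _ => hw i) ⟨i, Finset.mem_univ _, hi⟩
  have hmem : (0 : EuclideanSpace ℝ (Fin 2)) ∈
      convexHull ℝ ((fun i => (v i).val) '' {i | 0 < w i}) := by
    have hc : Finset.univ.centerMass w (fun i => (v i).val) = 0 := by
      rw [Finset.centerMass, h, smul_zero]
    rw [← hc, ← Finset.centerMass_filter_ne_zero]
    refine Finset.centerMass_mem_convexHull _ (fun i _ => hw i) ?_ ?_
    · rwa [Finset.sum_filter_ne_zero]
    · intro i hi
      exact ⟨i, (hw i).lt_of_ne' (Finset.mem_filter.1 hi).2, rfl⟩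
  obtain ⟨κ, _, z, a, hz, hind, ha, ha1, haz⟩ := eq_pos_convex_span_of_mem_convexHull hmem
  have hinner (k l : κ) : -(1 / 2) < inner ℝ (z k) (z l) := by
    obtain ⟨i, hi, hik⟩ := hz ⟨k, rfl⟩
    obtain ⟨j, hj, hjl⟩ := hz ⟨l, rfl⟩
    rw [← hik, ← hjl]
    by_contra! hle
    have := hv i j hi hj
    rw [dist_def] at this
    have h2 := Real.arccos_le_arccos hle
    have h3 : Real.arccos (-(1 / 2)) = 2 * Real.pi / 3 := by
      rw [Real.arccos_neg, ← Real.cos_pi_div_three, Real.arccos_cos] <;> linarith [Real.pi_pos]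
    linarith
  have hnorm (k : κ) : inner ℝ (z k) (z k) = (1 : ℝ) := by
    obtain ⟨i, -, hik⟩ := hz ⟨k, rfl⟩
    rw [← hik, real_inner_self_eq_norm_sq, (v i).norm_val, one_pow]
  have hcard : Fintype.card κ ≤ 3 := by
    refine hind.card_le_finrank_succ.trans ?_
    have := Submodule.finrank_le (vectorSpan ℝ (Set.range z))
    simp only [finrank_euclideanSpace, Fintype.card_fin] at this
    omega
  have : Nonempty κ := by
    by_contra hne
    rw [not_nonempty_iff] at hne
    simp at ha1
  -- Pair the relation with the point of largest weight: each of the at most two other terms exceeds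
  -- `-(a k / 2)`, so the total is positive.
  obtain ⟨k, -, hk⟩ := Finset.exists_max_image Finset.univ a Finset.univ_nonempty
  have hcard' : ((Finset.univ.erase k).card : ℝ) ≤ 2 := by
    rw [Finset.card_erase_of_mem (Finset.mem_univ k), Finset.card_univ]
    exact_mod_cast (by omega : Fintype.card κ - 1 ≤ 2)
  have h0 : ∑ l, a l * inner ℝ (z k) (z l) = 0 := by
    have : inner ℝ (z k) (∑ l, a l • z l) = 0 := by rw [haz, inner_zero_right]
    simpa only [inner_sum, inner_smul_right] using this
  rw [← Finset.add_sum_erase _ _ (Finset.mem_univ k), hnorm, mul_one] at h0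
  by_cases he : (Finset.univ.erase k).Nonempty
  · have h1 : ∑ l ∈ Finset.univ.erase k, -(a k / 2) <
        ∑ l ∈ Finset.univ.erase k, a l * inner ℝ (z k) (z l) := by
      refine Finset.sum_lt_sum_of_nonempty he fun l _ => ?_
      nlinarith [ha l, hinner k l, hk l (Finset.mem_univ l)]
    rw [Finset.sum_const, nsmul_eq_mul] at h1
    nlinarith [ha k]
  · rw [Finset.not_nonempty_iff_eq_empty.1 he, Finset.sum_empty] at h0
    linarith [ha k]

end GeoSphere

/-! ### The lower bound π/3 -/

namespace GeoSphere

variable {m : ℕ}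

theorem dist_neg_right (x y : GeoSphere m) : dist x (-y) = Real.pi - dist x y := by
  rw [dist_def, dist_def, neg_val, inner_neg_right, Real.arccos_neg]

theorem dist_neg_left (x y : GeoSphere m) : dist (-x) y = Real.pi - dist x y := by
  rw [dist_comm, dist_neg_right, dist_comm]

theorem dist_le_pi (x y : GeoSphere m) : dist x y ≤ Real.pi := Real.arccos_le_pi _

protected theorem neg_neg (x : GeoSphere m) : - -x = x := GeoSphere.ext (by simp)

theorem neg_dist_neg (x y : GeoSphere m) : dist (-x) (-y) = dist x y := by
  rw [dist_neg_right, dist_neg_left]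
  ring

theorem continuous_neg : Continuous fun x : GeoSphere m => -x :=
  (Isometry.of_dist_eq neg_dist_neg).continuous

/-- A map `S^2 → S^1` cannot have distortion less than `2π/3`. -/
theorem two_pi_div_three_le_of_abs_dist_sub_le {g : GeoSphere 2 → GeoSphere 1} {D : ℝ}
    (hg : ∀ x y, |dist (g x) (g y) - dist x y| ≤ D) : 2 * Real.pi / 3 ≤ D := by
  by_contra! hD
  -- Two net points within δ of the same x are less than 2δ apart, so their images are less than D +
  -- 2δ apart.
  obtain ⟨δ, hδ, hDδ⟩ : ∃ δ > 0, D + 2 * δ < 2 * Real.pi / 3 :=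
    ⟨(2 * Real.pi / 3 - D) / 3, by linarith, by linarith⟩
  obtain ⟨t, -, htf, ht⟩ := (isCompact_univ (X := GeoSphere 2)).finite_cover_balls hδ
  have := htf.fintype
  let ρ (y x : GeoSphere 2) : ℝ := max 0 (δ - dist x y)
  have hρ (y x : GeoSphere 2) : 0 < ρ y x → dist x y < δ := fun h => by
    rcases lt_max_iff.1 h with h | h <;> linarith
  have hρc (y : GeoSphere 2) : Continuous (ρ y) := by fun_prop
  let F (x : GeoSphere 2) : EuclideanSpace ℝ (Fin 2) :=
    ∑ y : t, (ρ y x • (g y).val - ρ y (-x) • (g y).val)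
  have hFc : Continuous F := by
    have h (y : GeoSphere 2) : Continuous fun x => ρ y (-x) := (hρc y).comp continuous_neg
    exact continuous_finsetSum _ fun y _ =>
      ((hρc y).smul continuous_const).sub ((h y).smul continuous_const)
  have hF0 (x : GeoSphere 2) : F x ≠ 0 := by
    -- The right copy of `t` carries the points -y near x with value -g(y); this makes `F` odd
    -- although `g` need not be.
    have key := sum_smul_val_ne_zero (ι := t ⊕ t)
      (Sum.elim (fun y => ρ y x) (fun y => ρ y (-x)))
      (Sum.elim (fun y => g y) (fun y => -g y)) (by rintro (y | y) <;> exact le_max_left _ _)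
      (by
        obtain ⟨y, hy, hxy⟩ := Set.mem_iUnion₂.1 (ht (Set.mem_univ x))
        exact ⟨.inl ⟨y, hy⟩, lt_max_of_lt_right (by simpa using hxy)⟩)
      (by
        rintro (⟨y, hy⟩ | ⟨y, hy⟩) (⟨z, hz⟩ | ⟨z, hz⟩) h1 h2 <;>
          simp only [Sum.elim_inl, Sum.elim_inr] at h1 h2 ⊢ <;>
          replace h1 := hρ _ _ h1 <;> replace h2 := hρ _ _ h2 <;>
          have h3 := abs_le.1 (hg y z)
        · linarith [dist_triangle_left y z x]
        · have h4 := dist_triangle x y z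
          rw [dist_neg_left] at h2
          rw [dist_neg_right]
          linarith
        · have h4 := dist_triangle_right x y z
          rw [dist_neg_left] at h1
          rw [dist_neg_left]
          linarith
        · rw [neg_dist_neg]
          linarith [dist_triangle_left y z (-x)])
    simpa [Fintype.sum_sum_type, F, sub_eq_add_neg, Finset.sum_add_distrib] using key
  let e : EuclideanSpace ℝ (Fin 2) ≃ₗᵢ[ℝ] ℂ := Complex.orthonormalBasisOneI.repr.symm
  obtain ⟨x, hx⟩ := exists_eq_zero_of_odd (f := fun x => e (F x)) (e.continuous.comp hFc)
    (fun x => by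
      rw [← map_neg]
      congr 1
      simp only [F, GeoSphere.neg_neg, ← Finset.sum_neg_distrib, neg_sub])
  exact hF0 x (by simpa using hx)

theorem pi_div_three_le_ghDist :
    Real.pi / 3 ≤ GromovHausdorff.ghDist (GeoSphere 1) (GeoSphere 2) := by
  obtain ⟨Φ, Ψ, hΦ, hΨ, h⟩ :=
    GromovHausdorff.ghDist_eq_hausdorffDist (GeoSphere 1) (GeoSphere 2)
  refine le_of_forall_gt_imp_ge_of_dense fun r hr => ?_
  have hex (y : GeoSphere 2) : ∃ x : GeoSphere 1, dist (Φ x) (Ψ y) < r := by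
    obtain ⟨_, ⟨x, rfl⟩, hx⟩ := Metric.exists_dist_lt_of_hausdorffDist_lt' (Set.mem_range_self y)
      (h ▸ hr) (Metric.hausdorffEDist_ne_top_of_nonempty_of_bounded (Set.range_nonempty _)
        (Set.range_nonempty _) (isCompact_range hΦ.continuous).isBounded
        (isCompact_range hΨ.continuous).isBounded)
    exact ⟨x, hx⟩
  choose g hg using hex
  have key := two_pi_div_three_le_of_abs_dist_sub_le (g := g) (D := 2 * r) fun x y => by
    rw [← hΦ.dist_eq, ← hΨ.dist_eq, abs_le]
    have h1 := dist_triangle4 (Φ (g x)) (Ψ x) (Ψ y) (Φ (g y))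
    have h2 := dist_triangle4 (Ψ x) (Φ (g x)) (Φ (g y)) (Ψ y)
    rw [dist_comm (Ψ y)] at h1
    rw [dist_comm (Ψ x) (Φ (g x))] at h2
    constructor <;> linarith [hg x, hg y]
  linarith

/-! ### The helmet -/

@[simp] theorem equatorial_val_last (x : GeoSphere m) :
    x.equatorial.val (Fin.last (m + 1)) = 0 := by
  simp [equatorial]

@[simp] theorem equatorial_val_castSucc (x : GeoSphere m) (i : Fin (m + 1)) :
    x.equatorial.val i.castSucc = x.val i := by
  simp [equatorial]

theorem inner_equatorial (x y : GeoSphere m) :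
    inner ℝ x.equatorial.val y.equatorial.val = inner ℝ x.val y.val := by
  simp only [PiLp.inner_apply]
  rw [Fin.sum_univ_castSucc]
  simp

theorem dist_equatorial (x y : GeoSphere m) : dist x.equatorial y.equatorial = dist x y := by
  rw [dist_def, dist_def, inner_equatorial]

theorem equatorial_injective : Function.Injective (equatorial (m := m)) := fun x y h => by
  rw [← dist_eq_zero, ← dist_equatorial, h, dist_self]

theorem neg_equatorial (x : GeoSphere m) : -x.equatorial = (-x).equatorial := by
  ext i
  refine Fin.lastCases ?_ (fun i => ?_) i <;> simp

theorem exists_equatorial_eq {p : GeoSphere (m + 1)} (h : p.val (Fin.last (m + 1)) = 0) :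
    ∃ x : GeoSphere m, x.equatorial = p := by
  refine ⟨⟨WithLp.toLp 2 fun i => p.val i.castSucc, ?_⟩, ?_⟩
  · have hp := p.norm_val
    rw [EuclideanSpace.norm_eq] at hp ⊢
    rw [Fin.sum_univ_castSucc, h] at hp
    simpa using hp
  · ext i
    refine Fin.lastCases ?_ (fun i => ?_) i <;> simp [h]

/-- Induction on the dimension: the sign of the last coordinate decides, and if it is 0 the point
comes from the equator. -/
theorem mem_helmet_or_neg_mem : ∀ {n : ℕ} (x : GeoSphere n), x ∈ helmet n ∨ -x ∈ helmet n
  | 0, x => by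
    have h := x.norm_val
    rw [EuclideanSpace.norm_eq, Real.sqrt_eq_one] at h
    have h2 : x.val 0 ^ 2 = 1 := by simpa using h
    rcases sq_eq_one_iff.1 h2 with h | h
    · exact .inl h
    · exact .inr (by simp [helmet, h])
  | n + 1, x => by
    rcases lt_trichotomy (x.val (Fin.last (n + 1))) 0 with h | h | h
    · exact .inr (.inl (by simpa [openUpperHemisphere] using h))
    · obtain ⟨y, rfl⟩ := exists_equatorial_eq h
      rw [neg_equatorial]
      exact (mem_helmet_or_neg_mem y).imp (fun h => .inr ⟨y, h, rfl⟩) (fun h => .inr ⟨-y, h, rfl⟩)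
    · exact .inl (.inl h)

theorem neg_notMem_helmet : ∀ {n : ℕ} {x : GeoSphere n}, x ∈ helmet n → -x ∉ helmet n
  | 0, x, h, h' => by
    simp only [helmet, Set.mem_ofPred_eq, neg_val, PiLp.neg_apply] at h h'
    linarith
  | n + 1, x, h, h' => by
    rcases h with h | ⟨y, hy, rfl⟩
    · rcases h' with h' | ⟨z, -, hz⟩
      · simp only [openUpperHemisphere, Set.mem_ofPred_eq, neg_val, PiLp.neg_apply] at h h'
        linarith
      · have := congrArg (fun p : GeoSphere (n + 1) => p.val (Fin.last (n + 1))) hz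
        simp only [openUpperHemisphere, Set.mem_ofPred_eq, equatorial_val_last, neg_val,
          PiLp.neg_apply] at h this
        linarith
    · rw [neg_equatorial] at h'
      rcases h' with h' | ⟨z, hz, hzy⟩
      · simp [openUpperHemisphere] at h'
      · rw [equatorial_injective hzy] at hz
        exact neg_notMem_helmet hy hz

theorem helmet_succ_subset (n : ℕ) : helmet (n + 1) ⊆ closedUpperHemisphere (n + 1) := by
  rintro x (h | ⟨y, -, rfl⟩)
  · exact le_of_lt (b := x.val (Fin.last (n + 1))) h
  · exact equatorial_mem_closedUpperHemisphere y

/-! ### The odd extension -/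

variable {ψ : closedUpperHemisphere 2 → GeoSphere 1}

open Classical in
/-- The odd extension to `S^2` of a map on the closed upper hemisphere, restricted to the helmet. -/
noncomputable def oddExtension (ψ : closedUpperHemisphere 2 → GeoSphere 1) (x : GeoSphere 2) :
    GeoSphere 1 :=
  if h : x ∈ helmet 2 then ψ ⟨x, helmet_succ_subset 1 h⟩
  else -ψ ⟨-x, helmet_succ_subset 1 ((mem_helmet_or_neg_mem x).resolve_left h)⟩

theorem isOddExtension_oddExtension (ψ : closedUpperHemisphere 2 → GeoSphere 1) :
    IsOddExtension ψ (oddExtension ψ) := by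
  refine ⟨fun x => ?_, fun p hp => by simp [oddExtension, hp]⟩
  by_cases h : x ∈ helmet 2
  · simp [oddExtension, h, neg_notMem_helmet h, GeoSphere.neg_neg]
  · have h' := (mem_helmet_or_neg_mem x).resolve_left h
    simp [oddExtension, h, h', GeoSphere.neg_neg]

theorem abs_dist_sub_le_of_isOddExtension {φ : GeoSphere 2 → GeoSphere 1}
    (hφ : IsOddExtension ψ φ) {D : ℝ}
    (hψ : ∀ p q, |dist (ψ p) (ψ q) - dist p q| ≤ D) (x y : GeoSphere 2) :
    |dist (φ x) (φ y) - dist x y| ≤ D := by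
  have key {x y : GeoSphere 2} (hx : x ∈ helmet 2) (hy : y ∈ helmet 2) :
      |dist (φ x) (φ y) - dist x y| ≤ D := by
    have h := hψ ⟨x, helmet_succ_subset 1 hx⟩ ⟨y, helmet_succ_subset 1 hy⟩
    rwa [← hφ.2 _ hx, ← hφ.2 _ hy] at h
  rcases mem_helmet_or_neg_mem x with hx | hx <;> rcases mem_helmet_or_neg_mem y with hy | hy <;>
    have h := key hx hy
  · exact h
  · rwa [hφ.1, dist_neg_right, dist_neg_right, sub_sub_sub_cancel_left, abs_sub_comm] at h
  · rwa [hφ.1, dist_neg_left, dist_neg_left, sub_sub_sub_cancel_left, abs_sub_comm] at h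
  · rwa [hφ.1, hφ.1, neg_dist_neg, neg_dist_neg] at h

/-! ### The Voronoi map -/

theorem exists_mem_voronoiCell {p : GeoSphere 2} (hp : p ∈ openUpperHemisphere 2) :
    ∃ i, p ∈ voronoiCell i := by
  let d (i : Fin 3) : ℝ := dist p (triangle i).equatorial
  obtain ⟨i, hi⟩ := Finite.exists_min d
  have hne : (Finset.univ.filter fun i => ∀ j, d i ≤ d j).Nonempty := ⟨i, by simpa using hi⟩
  obtain ⟨k, hk, hkmin⟩ := Finset.exists_min_image _ id hne
  simp only [Finset.mem_filter, Finset.mem_univ, true_and, id] at hk hkmin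
  refine ⟨k, hp, fun j _ => hk j, fun j hj => (hk j).lt_of_ne fun heq => ?_⟩
  exact absurd (hkmin j fun l => heq ▸ hk l) (not_le.2 hj)

theorem eq_of_mem_voronoiCell {p : GeoSphere 2} {i j : Fin 3} (hi : p ∈ voronoiCell i)
    (hj : p ∈ voronoiCell j) : i = j := by
  rcases lt_trichotomy i j with h | h | h
  · exact absurd (hi.2.1 j h.ne') (not_le.2 (hj.2.2 i h))
  · exact h
  · exact absurd (hj.2.1 i h.ne') (not_le.2 (hi.2.2 j h))

theorem exists_isVoronoiMap : ∃ ψ, IsVoronoiMap ψ := by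
  have h (p : closedUpperHemisphere 2) : ∃ y : GeoSphere 1,
      (∀ i, p.1 ∈ voronoiCell i → y = triangle i) ∧
      (∀ x : GeoSphere 1, x.equatorial = p.1 → y = x) := by
    rcases (show 0 ≤ p.1.val (Fin.last 2) from p.2).lt_or_eq with hp | hp
    · obtain ⟨i, hi⟩ := exists_mem_voronoiCell hp
      refine ⟨triangle i, fun j hj => by rw [eq_of_mem_voronoiCell hi hj], fun x hx => ?_⟩
      rw [← hx, equatorial_val_last] at hp
      exact absurd hp (lt_irrefl 0)
    · obtain ⟨y, hy⟩ := exists_equatorial_eq hp.symm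
      exact ⟨y, fun i hi => absurd hp (ne_of_lt (b := p.1.val (Fin.last 2)) hi.1),
        fun x hx => equatorial_injective (hy.trans hx.symm)⟩
  choose ψ hψ using h
  exact ⟨ψ, fun i p hp => (hψ p).1 i hp, fun x => (hψ _).2 x rfl⟩

end GeoSphere

/-! ### Distortion of the Voronoi map -/

namespace GeoSphere

theorem dist_le_dist_iff {m : ℕ} (p a q b : GeoSphere m) :
    dist p a ≤ dist q b ↔ inner ℝ q.val b.val ≤ inner ℝ p.val a.val := by
  have hb (x y : GeoSphere m) : inner ℝ x.val y.val ∈ Set.Icc (-1 : ℝ) 1 := by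
    have := abs_real_inner_le_norm x.val y.val
    rw [x.norm_val, y.norm_val, mul_one] at this
    exact abs_le.1 this
  exact Real.strictAntiOn_arccos.le_iff_ge (hb p a) (hb q b)

theorem dist_le_two_pi_div_three {m : ℕ} {p q : GeoSphere m}
    (h : -(1 / 2) ≤ inner ℝ p.val q.val) : dist p q ≤ 2 * Real.pi / 3 := by
  refine (Real.arccos_le_arccos h).trans_eq ?_
  rw [Real.arccos_neg, ← Real.cos_pi_div_three, Real.arccos_cos] <;> linarith [Real.pi_pos]

theorem dist_triangle_of_ne {i j : Fin 3} (h : i ≠ j) :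
    dist (triangle i) (triangle j) = 2 * Real.pi / 3 := by
  have h3 : √3 * √3 = (3 : ℝ) := Real.mul_self_sqrt (by norm_num)
  have hin : inner ℝ (triangle i).val (triangle j).val = -(1 / 2 : ℝ) := by
    fin_cases i <;> fin_cases j <;>
      simp [triangle, PiLp.inner_apply, Fin.sum_univ_two] at h ⊢ <;> nlinarith
  rw [dist_def, hin, Real.arccos_neg, ← Real.cos_pi_div_three, Real.arccos_cos] <;>
    linarith [Real.pi_pos]

/-- Two vectors of norm at most `1` in the sector of half-angle `π/3` around the first axis have
inner product at least `-1/2`. -/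
theorem neg_half_le_of_mem_sector {x y x' y' : ℝ} (h1 : y ≤ √3 * x) (h2 : -y ≤ √3 * x)
    (h1' : y' ≤ √3 * x') (h2' : -y' ≤ √3 * x') (hn : x ^ 2 + y ^ 2 ≤ 1)
    (hn' : x' ^ 2 + y' ^ 2 ≤ 1) : -(1 / 2) ≤ x * x' + y * y' := by
  have h3 : √3 ^ 2 = (3 : ℝ) := Real.sq_sqrt (by norm_num)
  have ha : |y| ≤ √3 * x := abs_le'.2 ⟨h1, h2⟩
  have ha' : |y'| ≤ √3 * x' := abs_le'.2 ⟨h1', h2'⟩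
  have hsq : y ^ 2 ≤ 3 * x ^ 2 := by
    have := pow_le_pow_left₀ (abs_nonneg y) ha 2
    rwa [sq_abs, mul_pow, h3] at this
  have hsq' : y' ^ 2 ≤ 3 * x' ^ 2 := by
    have := pow_le_pow_left₀ (abs_nonneg y') ha' 2
    rwa [sq_abs, mul_pow, h3] at this
  have hm : |y| * |y'| ≤ 3 * (x * x') := by
    refine (mul_le_mul ha ha' (abs_nonneg _) ((abs_nonneg _).trans ha)).trans_eq ?_
    linear_combination x * x' * h3
  have hneg : -(y * y') ≤ |y| * |y'| := by
    rw [← abs_mul]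
    exact neg_le_abs _
  -- The sector and norm bounds give y² ≤ 3/4, and likewise for y'.
  have hprod : |y| * |y'| ≤ 3 / 4 := by
    nlinarith [sq_nonneg (|y| - |y'|), sq_abs y, sq_abs y']
  linarith

theorem inner_triangle_equatorial (p : GeoSphere 2) (i : Fin 3) :
    inner ℝ p.val (triangle i).equatorial.val =
      ![p.val 0, -p.val 0 / 2 + √3 / 2 * p.val 1, -p.val 0 / 2 - √3 / 2 * p.val 1] i := by
  have h (x : GeoSphere 1) :
      inner ℝ p.val x.equatorial.val = x.val 0 * p.val 0 + x.val 1 * p.val 1 := by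
    rw [PiLp.inner_apply, Fin.sum_univ_castSucc]
    rw [equatorial_val_last, Fin.sum_univ_two, equatorial_val_castSucc, equatorial_val_castSucc]
    simp
  rw [h]
  fin_cases i <;> simp [triangle] <;> ring

theorem sum_sq_val (p : GeoSphere 2) : p.val 0 ^ 2 + p.val 1 ^ 2 + p.val 2 ^ 2 = 1 := by
  have h := p.norm_val
  rw [EuclideanSpace.norm_eq, Real.sqrt_eq_one] at h
  simpa [Fin.sum_univ_three] using h

theorem inner_le_of_mem_voronoiCell {p : GeoSphere 2} {i : Fin 3} (h : p ∈ voronoiCell i)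
    (j : Fin 3) : inner ℝ p.val (triangle j).equatorial.val ≤
      inner ℝ p.val (triangle i).equatorial.val := by
  by_cases hj : j = i
  · rw [hj]
  · exact (dist_le_dist_iff _ _ _ _).1 (h.2.1 j hj)

theorem dist_le_of_mem_voronoiCell {p q : GeoSphere 2} {i : Fin 3} (hp : p ∈ voronoiCell i)
    (hq : q ∈ voronoiCell i) : dist p q ≤ 2 * Real.pi / 3 := by
  apply dist_le_two_pi_div_three
  have hz : 0 ≤ p.val 2 * q.val 2 := mul_nonneg (le_of_lt hp.1) (le_of_lt hq.1)
  have hin : inner ℝ p.val q.val = p.val 0 * q.val 0 + p.val 1 * q.val 1 + p.val 2 * q.val 2 := by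
    simp [PiLp.inner_apply, Fin.sum_univ_three, mul_comm]
  have hpj := inner_le_of_mem_voronoiCell hp
  have hqj := inner_le_of_mem_voronoiCell hq
  simp only [inner_triangle_equatorial, Fin.forall_fin_succ] at hpj hqj
  have hpn := sum_sq_val p
  have hqn := sum_sq_val q
  have h3 : √3 ^ 2 = (3 : ℝ) := Real.sq_sqrt (by norm_num)
  have hpos : 0 < √3 := by positivity
  rw [hin]
  generalize p.val 0 = x, p.val 1 = y, p.val 2 = z, q.val 0 = x', q.val 1 = y', q.val 2 = z' at *
  have hsec {a b : ℝ} (h : √3 * b ≤ 3 * a) : b ≤ √3 * a := by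
    refine le_of_mul_le_mul_left ?_ hpos
    rwa [← mul_assoc, ← sq, h3]
  -- The rotation taking (c, e) to the first axis turns the Voronoi inequalities into the sector
  -- conditions. The third coordinates only increase the inner product.
  have hrot (c e : ℝ) (hce : c ^ 2 + e ^ 2 = 1)
      (h₁ : √3 * (c * y - e * x) ≤ 3 * (c * x + e * y))
      (h₂ : √3 * -(c * y - e * x) ≤ 3 * (c * x + e * y))
      (h₁' : √3 * (c * y' - e * x') ≤ 3 * (c * x' + e * y'))
      (h₂' : √3 * -(c * y' - e * x') ≤ 3 * (c * x' + e * y')) :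
      -(1 / 2) ≤ x * x' + y * y' + z * z' := by
    have := neg_half_le_of_mem_sector (hsec h₁) (hsec h₂) (hsec h₁') (hsec h₂')
      (by linear_combination (x ^ 2 + y ^ 2) * hce + hpn + sq_nonneg z)
      (by linear_combination (x' ^ 2 + y' ^ 2) * hce + hqn + sq_nonneg z')
    linear_combination this + (x * x' + y * y') * hce + hz
  fin_cases i <;> simp at hpj hqj
  · apply hrot 1 0 (by norm_num) <;> linarith
  · apply hrot (-1 / 2) (√3 / 2) (by linear_combination h3 / 4) <;> nlinarith
  · apply hrot (-1 / 2) (-(√3 / 2)) (by linear_combination h3 / 4) <;> nlinarith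

/-- The three vertices sum to 0, so the largest of the three inner products is nonnegative. -/
theorem dist_triangle_equatorial_le {p : GeoSphere 2} {i : Fin 3} (hp : p ∈ voronoiCell i) :
    dist p (triangle i).equatorial ≤ 2 * Real.pi / 3 := by
  apply dist_le_two_pi_div_three
  have h := inner_le_of_mem_voronoiCell hp
  have hs : ∑ j, inner ℝ p.val (triangle j).equatorial.val = (0 : ℝ) := by
    simp only [inner_triangle_equatorial, Fin.sum_univ_three]
    simp
    ring
  have h3 := Finset.sum_le_sum fun j (_ : j ∈ Finset.univ) => h j
  rw [hs] at h3
  simp at h3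
  linarith

theorem abs_dist_sub_le_of_isVoronoiMap {ψ : closedUpperHemisphere 2 → GeoSphere 1}
    (hψ : IsVoronoiMap ψ) (p q : closedUpperHemisphere 2) :
    |dist (ψ p) (ψ q) - dist p q| ≤ 2 * Real.pi / 3 := by
  have hpi := Real.pi_pos
  have hcases (p : closedUpperHemisphere 2) :
      (∃ i, p.1 ∈ voronoiCell i ∧ ψ p = triangle i) ∨ (ψ p).equatorial = p.1 := by
    rcases (show 0 ≤ p.1.val (Fin.last 2) from p.2).lt_or_eq with hp | hp
    · obtain ⟨i, hi⟩ := exists_mem_voronoiCell hp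
      exact .inl ⟨i, hi, hψ.1 i p hi⟩
    · obtain ⟨x, hx⟩ := exists_equatorial_eq hp.symm
      refine .inr ?_
      have := hψ.2 x
      simp only [hx] at this
      rw [this, hx]
  have hmixed {p q : closedUpperHemisphere 2} {i : Fin 3} (hp : p.1 ∈ voronoiCell i)
      (hpi : ψ p = triangle i) (hq : (ψ q).equatorial = q.1) :
      |dist (ψ p) (ψ q) - dist p q| ≤ 2 * Real.pi / 3 := by
    rw [Subtype.dist_eq, ← dist_equatorial, hpi, hq]
    exact (abs_dist_sub_le _ _ _).trans (dist_comm p.1 _ ▸ dist_triangle_equatorial_le hp)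
  rcases hcases p with ⟨i, hp, hpi⟩ | hp <;> rcases hcases q with ⟨j, hq, hqj⟩ | hq
  · rw [hpi, hqj, Subtype.dist_eq]
    by_cases hij : i = j
    · subst hij
      rw [dist_self, zero_sub, abs_neg, abs_of_nonneg dist_nonneg]
      exact dist_le_of_mem_voronoiCell hp hq
    · rw [dist_triangle_of_ne hij, abs_le]
      constructor <;> linarith [dist_le_pi p.1 q.1, dist_nonneg (x := p.1) (y := q.1)]
  · exact hmixed hp hpi hq
  · rw [dist_comm, dist_comm p]
    exact hmixed hq hqj hp
  · rw [Subtype.dist_eq, ← dist_equatorial, hp, hq, sub_self, abs_zero]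
    positivity

theorem IsVoronoiMap.surjective {ψ : closedUpperHemisphere 2 → GeoSphere 1}
    (hψ : IsVoronoiMap ψ) : Function.Surjective ψ := fun x => ⟨_, hψ.2 x⟩

/-- φ is the identity on the whole equator: on the helmet because ψ is, elsewhere by oddness. -/
theorem IsOddExtension.surjective {ψ : closedUpperHemisphere 2 → GeoSphere 1}
    {φ : GeoSphere 2 → GeoSphere 1} (hφ : IsOddExtension ψ φ) (hψ : IsVoronoiMap ψ) :
    Function.Surjective φ := fun x => by
  rcases mem_helmet_or_neg_mem x.equatorial with h | h
  · exact ⟨_, (hφ.2 ⟨_, x.equatorial_mem_closedUpperHemisphere⟩ h).trans (hψ.2 x)⟩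
  · rw [neg_equatorial] at h
    refine ⟨-(-x).equatorial, ?_⟩
    rw [hφ.1, hφ.2 ⟨_, (-x).equatorial_mem_closedUpperHemisphere⟩ h, hψ.2, GeoSphere.neg_neg]

end GeoSphere

/-! ### From surjections to correspondences and d_GH -/

theorem isCorrespondence_graphRel {X Y : Type*} {f : Y → X} (hf : Function.Surjective f) :
    IsCorrespondence (graphRel f) := by
  refine ⟨Set.eq_univ_of_forall fun x => ?_, Set.eq_univ_of_forall fun y => ⟨(f y, y), rfl, rfl⟩⟩
  obtain ⟨y, rfl⟩ := hf x
  exact ⟨(f y, y), rfl, rfl⟩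

theorem distortion_graphRel_le {X Y : Type*} [MetricSpace X] [MetricSpace Y] {f : Y → X} {D : ℝ}
    (h : ∀ y z, |dist (f y) (f z) - dist y z| ≤ D) :
    distortion (graphRel f) ≤ ENNReal.ofReal D := by
  refine iSup₂_le fun p hp => iSup₂_le fun q hq => ENNReal.ofReal_le_ofReal ?_
  rw [← show f p.2 = p.1 from hp, ← show f q.2 = q.1 from hq]
  exact h _ _

/-- A surjection of distortion at most `D` bounds the Gromov-Hausdorff distance by `D / 2`. -/
theorem ghDist_le_half_of_surjective {X Y : Type*} [MetricSpace X] [CompactSpace X] [Nonempty X]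
    [MetricSpace Y] [CompactSpace Y] [Nonempty Y] {f : Y → X} (hf : Function.Surjective f) {D : ℝ}
    (h : ∀ y z, |dist (f y) (f z) - dist y z| ≤ D) : GromovHausdorff.ghDist X Y ≤ D / 2 := by
  -- The bound is ε₁ + ε₂ / 2 + ε₃; all of `Y` and a surjective `f` make the outer terms 0.
  have key := GromovHausdorff.ghDist_le_of_approx_subsets (s := (Set.univ : Set Y))
    (fun y => f y.1) (ε₁ := 0) (ε₂ := D) (ε₃ := 0) (fun y => ⟨y, trivial, (dist_self y).le⟩)
    (fun x => by
      obtain ⟨y, rfl⟩ := hf x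
      exact ⟨⟨y, trivial⟩, (dist_self _).le⟩)
    (fun y z => by
      rw [abs_sub_comm]
      exact h y z)
  rw [GromovHausdorff.ghDist, dist_comm]
  simpa [GromovHausdorff.ghDist] using key

theorem mainTheorem2 :
    (∃ (R₁ : Set (GeoSphere 1 × GeoSphere.closedUpperHemisphere 2))
        (R₂ : Set (GeoSphere 1 × GeoSphere 2)),
      (IsCorrespondence R₁ ∧ distortion R₁ ≤ ENNReal.ofReal (2 * Real.pi / 3)) ∧
      (IsCorrespondence R₂ ∧ distortion R₂ ≤ ENNReal.ofReal (2 * Real.pi / 3)) ∧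
      (∃ (ψ : GeoSphere.closedUpperHemisphere 2 → GeoSphere 1) (φ : GeoSphere 2 → GeoSphere 1),
        GeoSphere.IsVoronoiMap ψ ∧ GeoSphere.IsOddExtension ψ φ ∧
          R₁ = graphRel ψ ∧ R₂ = graphRel φ)) ∧
    GromovHausdorff.ghDist (GeoSphere 1) (GeoSphere 2) = Real.pi / 3 := by
  obtain ⟨ψ, hψ⟩ := GeoSphere.exists_isVoronoiMap
  have hφ := GeoSphere.isOddExtension_oddExtension ψ
  have hdψ := GeoSphere.abs_dist_sub_le_of_isVoronoiMap hψ
  have hdφ := GeoSphere.abs_dist_sub_le_of_isOddExtension hφ hdψ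
  refine ⟨⟨_, _, ⟨isCorrespondence_graphRel hψ.surjective, distortion_graphRel_le hdψ⟩,
    ⟨isCorrespondence_graphRel (hφ.surjective hψ), distortion_graphRel_le hdφ⟩,
    ψ, _, hψ, hφ, rfl, rfl⟩, le_antisymm ?_ GeoSphere.pi_div_three_le_ghDist⟩
  refine (ghDist_le_half_of_surjective (hφ.surjective hψ) hdφ).trans_eq ?_
  ring
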